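/- Let $m\ge 2$, let $F$ be the finite field with $3^m$ elements, and let $a\in F$, $a\neq 0$. Let $\operatorname{Tr}:F\to\mathbb F_3$ be the absolute trace, $\omega=e^{2\pi i/3}$, and let $$K(a)=\sum_{x\in F}\omega^{\operatorname{Tr}(x+a/x)}$$ be the Kloosterman sum, where $a/0$ is read as $0$; it is a rational integer. For $k\ge 0$ say that $3^k$ exactly divides $K(a)$ if $3^k\mid K(a)$ and $3^{k+1}\nmid K(a)$ when $K(a)\ne 0$, and if $k=m$ when $K(a)=0$. Let $u_1,y\in F$ satisfy $y^2=u_1^3+u_1^2-a$ and $\operatorname{Tr}\left(\dfrac{a\,y}{u_1^3}\right)\neq 0$, where a quotient with denominator $0$ is read as $0$ (so that necessarily $u_1\neq0$). Let $u_1,u_2,\dots$ be the sequence of elements of $F$ given by $$u_{i+1}=\frac{(u_i^3-a)^3+a\,u_i^3}{(u_i^3-a)^2},\qquad i=1,2,\dots,$$ as long as $u_i\neq a^{1/3}$, where $a^{1/3}$ is the unique cube root of $a$ in $F$; the sequence stops if $a^{1/3}$ is reached. Then there is an integer $k$ with $1\le k\le m$ such that one of the following two cases takes place: (i) $u_k=a^{1/3}$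 and $u_i\neq a^{1/3}$ for all $1\le i<k$; or (ii) no term of the sequence equals $a^{1/3}$, and there is an integer $r\ge 1$ such that $u_{k+1}=u_{k+1+r}$ and the elements $u_i$ with $1\le i<k+1+r$ are pairwise different. In both cases $3^k$ exactly divides $K(a)$. -/

import Mathlib

namespace TernaryKloosterman

/-- The ternary Kloosterman sum `K(a) = ∑_{x ∈ F} ω ^ Tr(x + a / x)`, where `ω = exp(2πi/3)`
and `Tr` is the absolute trace from `F` to the field of three elements.
The sum includes `x = 0`, where `a / 0 = 0` (that is, `0⁻¹` is read as `0`).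
The additive character `ZMod.stdAddChar` of `ZMod 3` sends `j` to `exp(2πi j/3)`. -/
noncomputable def K {F : Type*} [Field F] [Fintype F] [Algebra (ZMod 3) F] (a : F) : ℂ :=
  ∑ x : F, (ZMod.stdAddChar (Algebra.trace (ZMod 3) F (x + a / x)) : ℂ)

/-- The affine points over `F` of the curve `y² = x³ + x² - a`. -/
def E {F : Type*} [Field F] (a : F) : Set (F × F) :=
  {P | P.2 ^ 2 = P.1 ^ 3 + P.1 ^ 2 - a}

/-- The sequence `u 1, u 2, …` (the value `u 0` plays no role) satisfies the recurrence
`u (i+1) = ((u i ^ 3 - a) ^ 3 + a * u i ^ 3) / (u i ^ 3 - a) ^ 2`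
at every step at which the right-hand side is defined, that is, where `u i` is not the
cube root of `a`. Nothing is required of a term that follows the cube root of `a`. -/
def IsTriplingSeq {F : Type*} [Field F] (a : F) (u : ℕ → F) : Prop :=
  ∀ i : ℕ, 1 ≤ i → u i ^ 3 ≠ a →
    u (i + 1) = ((u i ^ 3 - a) ^ 3 + a * u i ^ 3) / (u i ^ 3 - a) ^ 2

/-- The sequence reaches the cube root of `a` for the first time at index `k`.
(In characteristic three the cube root is unique, so `x = a^{1/3}` means `x ^ 3 = a`.) -/
def HitsCubeRootAt {F : Type*} [Field F] (a : F) (u : ℕ → F) (k : ℕ) : Prop :=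
  u k ^ 3 = a ∧ ∀ i : ℕ, 1 ≤ i → i < k → u i ^ 3 ≠ a

/-- The sequence never meets the cube root of `a` (so all its terms are given by the
recurrence), and for some `r ≥ 1` one has `u (k+1) = u (k+1+r)`, while the terms `u i` with
`1 ≤ i < k + 1 + r` are pairwise different. -/
def FirstRepeatsFrom {F : Type*} [Field F] (a : F) (u : ℕ → F) (k : ℕ) : Prop :=
  (∀ i : ℕ, 1 ≤ i → u i ^ 3 ≠ a) ∧
    ∃ r : ℕ, 1 ≤ r ∧ u (k + 1) = u (k + 1 + r) ∧
      ∀ i j : ℕ, 1 ≤ i → i < j → j < k + 1 + r → u i ≠ u j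

/-- `3 ^ k` is the exact power of three dividing the integer `N`, with the convention that
for `N = 0` this exact power is `3 ^ m`, the order of the field. -/
def ExactPower (m k : ℕ) (N : ℤ) : Prop :=
  (N ≠ 0 ∧ (3 : ℤ) ^ k ∣ N ∧ ¬ (3 : ℤ) ^ (k + 1) ∣ N) ∨ (N = 0 ∧ k = m)

end TernaryKloosterman

/-! Write q = 3^m. The curve y² = x³ + x² - a has q + K(a) points (`card_point`,
`K_eq_one_add_curveSum`), so its group order carries the 3-adic information about K(a). Tripling
acts on x-coordinates by the given recurrence (`three_nsmul_some`), hence `u (i + 1)` is the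
x-coordinate of 3^i P, with P = (u₁, y). The nonzero 3-torsion points are those with x³ = a, at most
two of them, so the 3-part of the group is cyclic. The trace condition says that P is not a triple
(`trace_eq_zero_of_three_nsmul`). Therefore ⟨P⟩ has index prime to 3 (`not_dvd_index_zmultiples`),
and the order of P is 3^k n with 3 ∤ n and 3^k the exact power in q + K(a). The orbit shows k: it
reaches 3-torsion at index k if n = 1, and otherwise becomes periodic from index k + 1
(`hits_or_repeats`). The elementary bound 2K(a) ≤ q + 3 gives q + K(a) < 2q, so k ≥ m forces k = m
and K(a) = 0; for k < m the same power exactly divides K(a). -/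

namespace TernaryKloosterman

/-! ### Divisibility and orders in abelian groups -/

section Group

variable {G : Type*} [AddCommGroup G]

/-- If the `p`-torsion of a finite abelian group has at most `p` elements, then an element that is
not a multiple of `p` generates a subgroup of index prime to `p`. -/
theorem not_dvd_index_zmultiples [Finite G] {p : ℕ} [Fact p.Prime]
    (htors : Nat.card (nsmulAddMonoidHom (α := G) p).ker ≤ p)
    {P : G} (hP : ∀ Q : G, p • Q ≠ P) :
    ¬ p ∣ (AddSubgroup.zmultiples P).index := by
  have hp : p.Prime := Fact.out
  set R := (nsmulAddMonoidHom (α := G) p).range with hR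
  have hmem : ∀ g : G, p • g ∈ R := fun g => ⟨g, rfl⟩
  have hcard : Nat.card (G ⧸ R) ≤ p := by
    have h1 := AddSubgroup.card_mul_index R
    have h2 := AddSubgroup.card_mul_index (nsmulAddMonoidHom (α := G) p).ker
    rw [AddSubgroup.index_ker] at h2
    have h3 : 0 < Nat.card R := Nat.card_pos
    rw [← hR, mul_comm, ← h1] at h2
    have h4 := Nat.eq_of_mul_eq_mul_left h3 h2
    change R.index ≤ p
    omega
  have hord : addOrderOf (P : G ⧸ R) = p := by
    apply addOrderOf_eq_prime
    · rw [← QuotientAddGroup.mk_nsmul, QuotientAddGroup.eq_zero_iff]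
      exact hmem P
    · rw [Ne, QuotientAddGroup.eq_zero_iff]
      rintro ⟨Q, hQ⟩
      exact hP Q hQ
  have htop : AddSubgroup.zmultiples (P : G ⧸ R) = ⊤ := by
    apply AddSubgroup.eq_top_of_le_card
    rw [Nat.card_zmultiples, hord]
    exact hcard
  have hdecomp : ∀ g : G, ∃ n : ℤ, ∃ h : G, g = n • P + p • h := by
    intro g
    have hg : (g : G ⧸ R) ∈ AddSubgroup.zmultiples (P : G ⧸ R) := htop ▸ AddSubgroup.mem_top _
    obtain ⟨n, hn⟩ := AddSubgroup.mem_zmultiples_iff.1 hg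
    rw [← QuotientAddGroup.mk_zsmul, QuotientAddGroup.eq] at hn
    obtain ⟨h, hh⟩ := hn
    refine ⟨n, h, ?_⟩
    have : p • h = -(n • P) + g := hh
    rw [this]; abel
  set S := AddSubgroup.zmultiples P with hS
  -- Since G = ⟨P⟩ + pG, multiplication by p is onto G/⟨P⟩, hence injective by finiteness; Cauchy's
  -- theorem then excludes p from the index.
  have hsurj : Function.Surjective (fun q : G ⧸ S => p • q) := by
    intro q
    obtain ⟨g, rfl⟩ := QuotientAddGroup.mk_surjective q
    obtain ⟨n, h, rfl⟩ := hdecomp g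
    refine ⟨(h : G ⧸ S), ?_⟩
    change p • (h : G ⧸ S) = _
    rw [← QuotientAddGroup.mk_nsmul, QuotientAddGroup.eq]
    refine AddSubgroup.mem_zmultiples_iff.2 ⟨n, ?_⟩
    abel
  have hinj := Finite.injective_iff_surjective.2 hsurj
  intro hdvd
  obtain ⟨q, hq⟩ := exists_prime_addOrderOf_dvd_card' (G := G ⧸ S) p hdvd
  have h0 : q = 0 := hinj (by simpa [hq] using addOrderOf_nsmul_eq_zero q)
  rw [h0, addOrderOf_zero] at hq
  exact hp.one_lt.ne hq

/-- If `3 ^ i • P = ± 3 ^ j • P` with `i < j`, then `i` is at least the exponent of three in the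
order of `P`. -/
theorem le_of_pow_three_nsmul_eq {P : G} {i j k : ℕ} (hij : i < j) (hk : 3 ^ k ∣ addOrderOf P)
    (h : 3 ^ i • P = 3 ^ j • P ∨ (3 ^ i • P : G) = -(3 ^ j • P : G)) : k ≤ i := by
  obtain ⟨d, rfl⟩ : ∃ d, j = i + (d + 1) := ⟨j - i - 1, by omega⟩
  -- Both signs reduce to 3^i (3^(j-i) ± 1) killing P, where the second factor is prime to 3.
  have key : ∀ e : ℤ, ((3 : ℤ) ^ i * (3 * 3 ^ d + e)) • P = 0 → IsUnit e → k ≤ i := by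
    intro e h0 he
    have h1 : (3 : ℤ) ^ k ∣ 3 ^ i * (3 * 3 ^ d + e) := by
      refine dvd_trans ?_ (addOrderOf_dvd_iff_zsmul_eq_zero.2 h0)
      exact_mod_cast hk
    have h2 : IsCoprime ((3 : ℤ) ^ k) (3 * 3 ^ d + e) := by
      apply IsCoprime.pow_left
      rw [add_comm]
      exact IsCoprime.add_mul_left_right (isCoprime_one_right.of_isCoprime_of_dvd_right
        he.dvd) _
    have h3 := h2.dvd_of_dvd_mul_right h1
    exact (Nat.pow_dvd_pow_iff_le_right' (b := 1)).1 (by exact_mod_cast h3)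
  rcases h with h | h
  · refine key (-1) ?_ (by simp)
    have : ((3 : ℤ) ^ i * (3 * 3 ^ d + -1)) = (3 ^ (i + (d + 1)) : ℕ) - (3 ^ i : ℕ) := by
      push_cast; ring
    rw [this, sub_smul, natCast_zsmul, natCast_zsmul, h, sub_self]
  · refine key 1 ?_ (by simp)
    have : ((3 : ℤ) ^ i * (3 * 3 ^ d + 1)) = (3 ^ (i + (d + 1)) : ℕ) + (3 ^ i : ℕ) := by
      push_cast; ring
    rw [this, add_smul, natCast_zsmul, natCast_zsmul]
    exact h ▸ add_neg_cancel _

theorem exists_pow_three_nsmul_eq {P : G} {k n : ℕ} (hP : addOrderOf P = 3 ^ k * n)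
    (hn : ¬ 3 ∣ n) : ∃ r : ℕ, 1 ≤ r ∧ 3 ^ (k + r) • P = 3 ^ k • P := by
  have hn0 : 0 < n := Nat.pos_of_ne_zero (by rintro rfl; simp at hn)
  refine ⟨n.totient, Nat.totient_pos.2 hn0, ?_⟩
  rw [nsmul_eq_nsmul_iff_modEq, hP, pow_add]
  have := Nat.ModEq.pow_totient (x := 3) (n := n) ((Nat.Prime.coprime_iff_not_dvd Nat.prime_three).2 hn)
  simpa using this.mul_left' (3 ^ k)

end Group

/-! ### The curve and its tripling formula -/

section Curve

variable {F : Type*} [Field F]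

theorem three_eq_zero [Algebra (ZMod 3) F] : (3 : F) = 0 := by
  have h : (3 : ZMod 3) = 0 := rfl
  rw [← map_ofNat (algebraMap (ZMod 3) F) 3, h, map_zero]

/-- The Weierstrass curve `y² = x³ + x² - a`. -/
def curve (a : F) : WeierstrassCurve.Affine F where
  a₁ := 0
  a₂ := 1
  a₃ := 0
  a₄ := 0
  a₆ := -a

theorem curve_equation_iff {a x y : F} : (curve a).Equation x y ↔ (x, y) ∈ E a := by
  rw [WeierstrassCurve.Affine.equation_iff]
  simp [curve, E, sub_eq_add_neg]

theorem curve_Δ_ne_zero [Algebra (ZMod 3) F] {a : F} (ha : a ≠ 0) : (curve a).Δ ≠ 0 := by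
  have h3 : (3 : F) = 0 := three_eq_zero
  have : (curve a).Δ = a := by
    simp only [WeierstrassCurve.Δ, WeierstrassCurve.b₂, WeierstrassCurve.b₄, WeierstrassCurve.b₆,
      WeierstrassCurve.b₈, curve]
    linear_combination (21 * a - 144 * a ^ 2) * h3
  rwa [this]

theorem curve_nonsingular [Algebra (ZMod 3) F] {a x y : F} (ha : a ≠ 0) (h : (x, y) ∈ E a) :
    (curve a).Nonsingular x y :=
  (WeierstrassCurve.Affine.equation_iff_nonsingular_of_Δ_ne_zero (curve_Δ_ne_zero ha)).1
    (curve_equation_iff.2 h)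

theorem mem_E_of_nonsingular {a x y : F} (h : (curve a).Nonsingular x y) : (x, y) ∈ E a :=
  curve_equation_iff.1 h.1

theorem cube_injective [Algebra (ZMod 3) F] {x z : F} (h : x ^ 3 = z ^ 3) : x = z := by
  have h3 : (3 : F) = 0 := three_eq_zero
  have : (x - z) ^ 3 = 0 := by linear_combination h + (x * z ^ 2 - x ^ 2 * z) * h3
  exact sub_eq_zero.1 (pow_eq_zero_iff (by norm_num) |>.1 this)

open WeierstrassCurve.Affine

theorem exists_some_eq {W : WeierstrassCurve.Affine F} {x y x' y' : F} (h : W.Nonsingular x y)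
    (hx : x = x') (hy : y = y') : ∃ h', Point.some x y h = Point.some x' y' h' := by
  subst hx hy
  exact ⟨h, rfl⟩

variable [DecidableEq F]

/-- Points whose `x`-coordinate is the cube root of `a` are killed by three. -/
theorem three_nsmul_some_of_eq [Algebra (ZMod 3) F] {a x y : F} (ha : a ≠ 0)
    (h : (curve a).Nonsingular x y) (hx : x ^ 3 = a) : 3 • Point.some x y h = 0 := by
  have h3 : (3 : F) = 0 := three_eq_zero
  have hE : y ^ 2 = x ^ 3 + x ^ 2 - a := mem_E_of_nonsingular h
  have hx0 : x ≠ 0 := by rintro rfl; simp at hx; exact ha hx.symm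
  have hyy : y ^ 2 = x ^ 2 := by rw [hE, hx]; ring
  have hy0 : y ≠ 0 := by rintro rfl; simp at hyy; exact hx0 (by simpa using hyy.symm)
  have hneg : y ≠ (curve a).negY x y := by
    simp only [negY, curve]
    intro h'
    apply hy0
    linear_combination (-h') + y * h3
  have hsl : (curve a).slope x x y y = x / y := by
    rw [slope_of_Y_ne rfl hneg]
    simp only [negY, curve]
    have : y - (-y - 0 * x - 0) = -y := by linear_combination y * h3
    rw [this]
    field_simp
    linear_combination (-x ^ 2 - x) * h3
  -- The tangent slope x/y is ±1, which makes 2P = -P.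
  have hsq : (x / y) ^ 2 = 1 := by rw [div_pow, hyy, div_self (pow_ne_zero 2 hx0)]
  have hdbl : Point.some x y h + Point.some x y h = -Point.some x y h := by
    rw [Point.add_self_of_Y_ne hneg, Point.neg_some]
    simp only [Point.some.injEq, addX, addY, negAddY, negY, hsl]
    simp only [curve, hsq]
    refine ⟨by linear_combination (-x) * h3, by linear_combination (x ^ 2 / y) * h3⟩
  rw [succ_nsmul, two_nsmul, hdbl, neg_add_cancel]

/-- The tripling formula on `y² = x³ + x² - a` in characteristic three. -/
theorem three_nsmul_some [Algebra (ZMod 3) F] {a x y : F}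
    (h : (curve a).Nonsingular x y) (hx : x ^ 3 ≠ a) :
    ∃ h', 3 • Point.some x y h = Point.some
      (((x ^ 3 - a) ^ 3 + a * x ^ 3) / (x ^ 3 - a) ^ 2)
      (y ^ 3 * (y ^ 6 - (x ^ 3 - a) ^ 2) / (x ^ 3 - a) ^ 3) h' := by
  have h3 : (3 : F) = 0 := three_eq_zero
  have hE : y ^ 2 = x ^ 3 + x ^ 2 - a := mem_E_of_nonsingular h
  have hd : x ^ 3 - a ≠ 0 := sub_ne_zero.2 hx
  obtain ⟨d, hdef⟩ : ∃ d, d = x ^ 3 - a := ⟨_, rfl⟩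
  have haE : a = x ^ 3 - d := by rw [hdef]; ring
  rw [← hdef] at hd ⊢
  have hyd : y ^ 2 = x ^ 2 + d := by rw [hE, hdef]; ring
  -- If y = 0 then P is 2-torsion and 3P = P; the formula agrees because d = -x².
  by_cases hy0 : y = 0
  · subst hy0
    have hx0 : x ≠ 0 := by
      rintro rfl
      apply hd
      linear_combination -hyd
    have hdx : d = -x ^ 2 := by linear_combination -hyd
    have hneg : (0 : F) = (curve a).negY x 0 := by simp [negY, curve]
    have hX : (d ^ 3 + a * x ^ 3) / d ^ 2 = x := by
      rw [haE, hdx]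
      field_simp
      ring
    have hY : (0 : F) ^ 3 * (0 ^ 6 - d ^ 2) / d ^ 3 = 0 := by simp
    rw [hX, hY]
    refine ⟨h, ?_⟩
    rw [succ_nsmul, two_nsmul, Point.add_self_of_Y_eq hneg, zero_add]
  · have hneg : y ≠ (curve a).negY x y := by
      simp only [negY, curve]
      intro h'
      apply hy0
      linear_combination (-h') + y * h3
    have hsl : (curve a).slope x x y y = x / y := by
      rw [slope_of_Y_ne rfl hneg]
      simp only [negY, curve]
      have : y - (-y - 0 * x - 0) = -y := by linear_combination y * h3
      rw [this]
      field_simp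
      linear_combination (-x ^ 2 - x) * h3
    have hX2 : (curve a).addX x x ((curve a).slope x x y y) = x - d / y ^ 2 := by
      rw [hsl]
      simp only [addX, curve]
      field_simp
      linear_combination (-1 : F) * hyd - x * y ^ 2 * h3
    have hY2 : (curve a).addY x x y ((curve a).slope x x y y) = -y + x * d / y ^ 3 := by
      rw [addY, negAddY, hX2, hsl]
      simp only [negY, curve]
      field_simp
      ring
    have hne : x - d / y ^ 2 ≠ x := by
      intro h'
      have : d / y ^ 2 = 0 := by linear_combination -h'
      exact div_ne_zero hd (pow_ne_zero 2 hy0) this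
    have hsl2 : (curve a).slope (x - d / y ^ 2) x (-y + x * d / y ^ 3) y
        = -(y ^ 3 / d + x / y) := by
      rw [slope_of_X_ne hne]
      have : x - d / y ^ 2 - x = - (d / y ^ 2) := by ring
      rw [this]
      field_simp
      linear_combination y ^ 4 * h3
    have hX3 : (curve a).addX (x - d / y ^ 2) x
        ((curve a).slope (x - d / y ^ 2) x (-y + x * d / y ^ 3) y)
        = (d ^ 3 + a * x ^ 3) / d ^ 2 := by
      rw [hsl2, haE]
      simp only [addX, curve]
      field_simp
      clear hE hdef haE hsl hX2 hY2 hne hsl2 hneg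
      grind
    have hY3 : (curve a).addY (x - d / y ^ 2) x (-y + x * d / y ^ 3)
        ((curve a).slope (x - d / y ^ 2) x (-y + x * d / y ^ 3) y)
        = y ^ 3 * (y ^ 6 - d ^ 2) / d ^ 3 := by
      rw [addY, negAddY, hX3, hsl2, haE]
      simp only [negY, curve]
      field_simp
      clear hE hdef haE hsl hX2 hX3 hY2 hne hsl2 hneg
      grind
    have hdbl : ∃ h', Point.some x y h + Point.some x y h =
        Point.some (x - d / y ^ 2) (-y + x * d / y ^ 3) h' := by
      rw [Point.add_self_of_Y_ne hneg]
      exact exists_some_eq _ hX2 hY2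
    obtain ⟨h', hdbl⟩ := hdbl
    rw [succ_nsmul, two_nsmul, hdbl, Point.add_of_X_ne hne]
    exact exists_some_eq _ hX3 hY3

end Curve

/-! ### Three-torsion and the trace obstruction to divisibility -/

section Torsion

variable {F : Type*} [Field F] [Algebra (ZMod 3) F]

theorem trace_cube [Fintype F] (z : F) :
    Algebra.trace (ZMod 3) F (z ^ 3) = Algebra.trace (ZMod 3) F z := by
  have : CharP F 3 := charP_of_injective_algebraMap (algebraMap (ZMod 3) F).injective 3
  have : ExpChar F 3 := ExpChar.prime Nat.prime_three
  have := Algebra.trace_eq_of_algEquiv (FiniteField.frobeniusAlgEquiv (ZMod 3) F 3) z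
  simpa using this

open WeierstrassCurve.Affine

variable [DecidableEq F]

theorem three_nsmul_some_eq_zero_iff {a x y : F} (ha : a ≠ 0)
    (h : (curve a).Nonsingular x y) : 3 • Point.some x y h = 0 ↔ x ^ 3 = a := by
  refine ⟨fun h0 => ?_, three_nsmul_some_of_eq ha h⟩
  by_contra hx
  obtain ⟨h', e⟩ := three_nsmul_some h hx
  rw [e] at h0
  exact Point.some_ne_zero h' h0

/-- Cube roots are unique in characteristic three, so all nonzero 3-torsion points share one
x-coordinate and agree up to sign. -/
theorem card_three_torsion_le {a : F} (ha : a ≠ 0) :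
    Nat.card (nsmulAddMonoidHom (α := (curve a).Point) 3).ker ≤ 3 := by
  have hsub : ∃ Q : (curve a).Point, ∀ R : (curve a).Point, 3 • R = 0 → R = 0 ∨ R = Q ∨ R = -Q := by
    by_cases hQ : ∃ x y, ∃ _ : (curve a).Nonsingular x y, x ^ 3 = a
    · obtain ⟨x, y, h, hx⟩ := hQ
      refine ⟨Point.some x y h, fun R hR => ?_⟩
      rcases R with _ | ⟨x', y', h'⟩
      · exact Or.inl rfl
      · right
        have := (three_nsmul_some_eq_zero_iff ha h').1 hR
        exact Point.X_eq_iff.1 (cube_injective (this.trans hx.symm))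
    · refine ⟨0, fun R hR => ?_⟩
      rcases R with _ | ⟨x', y', h'⟩
      · exact Or.inl rfl
      · exact absurd ⟨x', y', h', (three_nsmul_some_eq_zero_iff ha h').1 hR⟩ hQ
  obtain ⟨Q, hQ⟩ := hsub
  have h1 : ((nsmulAddMonoidHom (α := (curve a).Point) 3).ker : Set (curve a).Point)
      ⊆ (({0, Q, -Q} : Finset (curve a).Point) : Set (curve a).Point) := by
    intro R hR
    have := hQ R hR
    simpa using this
  calc Nat.card (nsmulAddMonoidHom (α := (curve a).Point) 3).ker
      = Set.ncard ((nsmulAddMonoidHom (α := (curve a).Point) 3).ker : Set (curve a).Point) := rfl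
    _ ≤ Set.ncard (({0, Q, -Q} : Finset (curve a).Point) : Set (curve a).Point) :=
        Set.ncard_le_ncard h1 (Finset.finite_toSet _)
    _ = ({0, Q, -Q} : Finset (curve a).Point).card := Set.ncard_coe_finset _
    _ ≤ 3 := Finset.card_le_three

/-- The function `a y / x ^ 3` takes a value of trace zero at every point that is divisible
by three: pulled back along tripling it has the form `z ^ 3 - z`. -/
theorem trace_eq_zero_of_three_nsmul [Fintype F] {a x y : F} (ha : a ≠ 0)
    (h : (curve a).Nonsingular x y) {Q : (curve a).Point} (hQ : 3 • Q = Point.some x y h) :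
    Algebra.trace (ZMod 3) F (a * y / x ^ 3) = 0 := by
  have h3 : (3 : F) = 0 := three_eq_zero
  rcases Q with _ | ⟨s, t, hs⟩
  · exact absurd (hQ.symm.trans (smul_zero 3)) (Point.some_ne_zero h)
  by_cases hsa : s ^ 3 = a
  · rw [three_nsmul_some_of_eq ha hs hsa] at hQ
    exact absurd hQ.symm (Point.some_ne_zero h)
  obtain ⟨h', e⟩ := three_nsmul_some hs hsa
  rw [e, Point.some.injEq] at hQ
  obtain ⟨rfl, rfl⟩ := hQ
  have hE : t ^ 2 = s ^ 3 + s ^ 2 - a := mem_E_of_nonsingular hs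
  have hd : s ^ 3 - a ≠ 0 := sub_ne_zero.2 hsa
  -- This is the case where 3Q has x-coordinate 0, and the quotient takes its default value 0.
  by_cases hD : (s ^ 3 - a) ^ 3 + a * s ^ 3 = 0
  · simp [hD]
  have key : a * (t ^ 3 * (t ^ 6 - (s ^ 3 - a) ^ 2) / (s ^ 3 - a) ^ 3) /
      (((s ^ 3 - a) ^ 3 + a * s ^ 3) / (s ^ 3 - a) ^ 2) ^ 3 =
      (-a * t ^ 3 / ((s ^ 3 - a) ^ 3 + a * s ^ 3)) ^ 3
        - (-a * t ^ 3 / ((s ^ 3 - a) ^ 3 + a * s ^ 3)) := by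
    have h6 : t ^ 6 = (s ^ 3 + s ^ 2 - a) ^ 3 := by rw [← hE]; ring
    obtain ⟨X, hX⟩ : ∃ X, X = s ^ 3 := ⟨_, rfl⟩
    obtain ⟨d, hdd⟩ : ∃ d, d = X - a := ⟨_, rfl⟩
    have h6' : t ^ 6 = d ^ 3 + X ^ 2 := by
      rw [h6]
      subst hdd hX
      linear_combination ((s ^ 3 - a) ^ 2 * s ^ 2 + (s ^ 3 - a) * s ^ 4) * h3
    rw [← hX, ← hdd] at hD hd ⊢
    field_simp
    grind
  rw [key, map_sub, trace_cube, sub_self]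

end Torsion

/-! ### From the Kloosterman sum to the point count -/

section CharacterSum

variable {F : Type*} [Field F] [Fintype F] [Algebra (ZMod 3) F]

omit [Fintype F] in
theorem ringChar_ne_two : ringChar F ≠ 2 := by
  have : CharP F 3 := charP_of_injective_algebraMap (algebraMap (ZMod 3) F).injective 3
  rw [ringChar.eq F 3]
  norm_num

/-- Additive Hilbert 90 for a finite field of characteristic three. -/
theorem exists_cube_sub_self_iff (v : F) :
    (∃ z : F, z ^ 3 - z = v) ↔ Algebra.trace (ZMod 3) F v = 0 := by
  have h3 : (3 : F) = 0 := three_eq_zero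
  constructor
  · rintro ⟨z, rfl⟩
    rw [map_sub, trace_cube, sub_self]
  · let φ : F →+ F :=
      { toFun := fun z => z ^ 3 - z
        map_zero' := by simp
        map_add' := fun x y => by linear_combination (x ^ 2 * y + x * y ^ 2) * h3 }
    let τ : F →+ ZMod 3 := (Algebra.trace (ZMod 3) F).toAddMonoidHom
    have hle : φ.range ≤ τ.ker := by
      rintro _ ⟨z, rfl⟩
      change Algebra.trace (ZMod 3) F (z ^ 3 - z) = 0
      rw [map_sub, trace_cube, sub_self]
    have hτ : Nat.card τ.range = 3 := by
      have : τ.range = ⊤ := AddMonoidHom.range_eq_top.2 (Algebra.trace_surjective (ZMod 3) F)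
      rw [this, AddSubgroup.card_top, Nat.card_zmod]
    have hφ : Nat.card φ.ker ≤ 3 := by
      classical
      have hsub : (φ.ker : Set F) ⊆ (({0, 1, -1} : Finset F) : Set F) := by
        intro z hz
        have h0 : z ^ 3 - z = 0 := hz
        have h1 : z * ((z - 1) * (z + 1)) = 0 := by rw [← h0]; ring
        rcases mul_eq_zero.1 h1 with h | h
        · simp [h]
        · rcases mul_eq_zero.1 h with h | h
          · simp [sub_eq_zero.1 h]
          · simp [eq_neg_of_add_eq_zero_left h]
      calc Nat.card φ.ker = Set.ncard (φ.ker : Set F) := rfl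
        _ ≤ Set.ncard (({0, 1, -1} : Finset F) : Set F) :=
          Set.ncard_le_ncard hsub (Finset.finite_toSet _)
        _ = ({0, 1, -1} : Finset F).card := Set.ncard_coe_finset _
        _ ≤ 3 := Finset.card_le_three
    have c1 := AddSubgroup.card_mul_index φ.ker
    have c2 := AddSubgroup.card_mul_index τ.ker
    rw [AddSubgroup.index_ker] at c1 c2
    rw [hτ] at c2
    have hcard : Nat.card τ.ker ≤ Nat.card φ.range := by
      have h1 : Nat.card φ.ker * Nat.card φ.range ≤ 3 * Nat.card φ.range :=
        Nat.mul_le_mul_right _ hφ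
      omega
    have heq : φ.range = τ.ker := AddSubgroup.eq_of_le_of_card_ge hle hcard
    intro hv
    have : v ∈ φ.range := by rw [heq]; exact hv
    exact this

/-- The canonical additive character of `F`. -/
noncomputable def traceChar (x : F) : ℂ := ZMod.stdAddChar (Algebra.trace (ZMod 3) F x)

theorem one_add_stdAddChar_add_stdAddChar_neg (t : ZMod 3) :
    (1 + ZMod.stdAddChar t + ZMod.stdAddChar (-t) : ℂ) = if t = 0 then 3 else 0 := by
  by_cases ht : t = 0
  · subst ht; norm_num
  · have h := AddChar.sum_mulShift (R := ZMod 3) (R' := ℂ) t (ZMod.isPrimitive_stdAddChar 3)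
    rw [if_neg ht]
    rw [if_neg ht] at h
    have hu : (Finset.univ : Finset (ZMod 3)) = {0, 1, -1} := by decide
    rw [hu, Finset.sum_insert (by decide), Finset.sum_insert (by decide),
      Finset.sum_singleton] at h
    simpa [add_assoc] using h

variable [DecidableEq F]

theorem card_cube_sub_self (v : F) :
    ((Finset.univ.filter fun z : F => z ^ 3 - z = v).card : ℂ) =
      1 + traceChar v + traceChar (-v) := by
  have h3 : (3 : F) = 0 := three_eq_zero
  rw [traceChar, traceChar, map_neg, one_add_stdAddChar_add_stdAddChar_neg]
  split_ifs with h
  · obtain ⟨w, hw⟩ := (exists_cube_sub_self_iff v).2 h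
    have hset : (Finset.univ.filter fun z : F => z ^ 3 - z = v) = {w, w + 1, w - 1} := by
      ext z
      simp only [Finset.mem_filter, Finset.mem_univ, true_and, Finset.mem_insert,
        Finset.mem_singleton]
      constructor
      · intro hz
        have h1 : (z - w) * ((z - (w + 1)) * (z - (w - 1))) = 0 := by
          linear_combination hz - hw + (z * w ^ 2 - z ^ 2 * w) * h3
        rcases mul_eq_zero.1 h1 with h | h
        · exact Or.inl (sub_eq_zero.1 h)
        · rcases mul_eq_zero.1 h with h | h
          · exact Or.inr (Or.inl (sub_eq_zero.1 h))
          · exact Or.inr (Or.inr (sub_eq_zero.1 h))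
      · rintro (rfl | rfl | rfl)
        · exact hw
        · linear_combination hw + (w ^ 2 + w) * h3
        · linear_combination hw + (-w ^ 2 + w) * h3
    have hne : (1 : F) ≠ -1 := by
      intro h1
      exact one_ne_zero (α := F) (by linear_combination h3 - h1)
    rw [hset, Finset.card_insert_of_notMem, Finset.card_pair]
    · norm_num
    · intro h1; apply hne; linear_combination h1
    · simp only [Finset.mem_insert, Finset.mem_singleton, not_or]
      exact ⟨by simp, fun h1 => one_ne_zero (α := F) (by linear_combination h1)⟩
  · rw [Finset.card_eq_zero.2, Nat.cast_zero]
    rw [Finset.filter_eq_empty_iff]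
    exact fun z _ hz => h ((exists_cube_sub_self_iff v).1 ⟨z, hz⟩)

theorem card_sq_eq (c : F) :
    ((Finset.univ.filter fun x : F => x ^ 2 = c).card : ℤ) = quadraticChar F c + 1 := by
  rw [← quadraticChar_card_sqrts ringChar_ne_two c]
  congr 2
  ext x
  simp

/-- Completing the square: x² - vx + a = 0 reads (x + v)² = v² - a, since 2 = -1 and 4 = 1. -/
theorem card_add_div_eq {a : F} (ha : a ≠ 0) (v : F) :
    ((Finset.univ.filter fun x : F => x ≠ 0 ∧ x + a / x = v).card : ℤ) =
      quadraticChar F (v ^ 2 - a) + 1 := by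
  have h3 : (3 : F) = 0 := three_eq_zero
  rw [← card_sq_eq]
  congr 1
  refine Finset.card_bij (fun x _ => x + v) ?_ ?_ ?_
  · intro x hx
    simp only [Finset.mem_filter, Finset.mem_univ, true_and] at hx ⊢
    obtain ⟨hx0, rfl⟩ := hx
    field_simp
    linear_combination (x ^ 4 + a * x ^ 2) * h3
  · intro x _ y _ h
    exact add_right_cancel h
  · intro w hw
    simp only [Finset.mem_filter, Finset.mem_univ, true_and] at hw
    have hx0 : w - v ≠ 0 := by
      intro h
      apply ha
      linear_combination hw - (w + v) * h
    refine ⟨w - v, ?_, by ring⟩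
    simp only [Finset.mem_filter, Finset.mem_univ, true_and]
    refine ⟨hx0, ?_⟩
    field_simp
    linear_combination hw + (v ^ 2 - w * v) * h3

/-- The character sum attached to the curve `y² = x³ + x² - a`. -/
noncomputable def curveSum (a : F) : ℤ := ∑ x : F, quadraticChar F (x ^ 3 + x ^ 2 - a)

theorem sum_comp_sq (g : F → ℤ) :
    ∑ z : F, g (z ^ 2) = ∑ s : F, (quadraticChar F s + 1) * g s := by
  rw [← Finset.sum_fiberwise Finset.univ (fun z : F => z ^ 2)]
  refine Finset.sum_congr rfl fun s _ => ?_
  rw [← card_sq_eq, Finset.sum_congr rfl (g := fun _ => g s), Finset.sum_const, nsmul_eq_mul]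
  intro z hz
  rw [(Finset.mem_filter.1 hz).2]

omit [Algebra (ZMod 3) F] in
theorem quadraticChar_mul_sq {c : F} (hc : c ≠ 0) (x : F) :
    quadraticChar F (x * c ^ 2) = quadraticChar F x := by
  rw [map_mul, quadraticChar_sq_one' hc, mul_one]

theorem sum_quadraticChar_shift (a : F) :
    ∑ s : F, quadraticChar F (s ^ 3 + s ^ 2 + s - a) = curveSum a := by
  have h3 : (3 : F) = 0 := three_eq_zero
  rw [curveSum, ← Equiv.sum_comp (Equiv.addRight (1 : F))]
  refine Finset.sum_congr rfl fun s _ => ?_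
  congr 1
  simp only [Equiv.coe_addRight]
  linear_combination (s ^ 2 + 2 * s + 1) * h3

theorem curveSum_cube (a : F) : curveSum (a ^ 3) = curveSum a := by
  have h3 : (3 : F) = 0 := three_eq_zero
  have hb : Function.Bijective (fun x : F => x ^ 3) :=
    Finite.injective_iff_bijective.1 fun x y h => cube_injective h
  rw [curveSum, curveSum, ← hb.sum_comp]
  refine Finset.sum_congr rfl fun x _ => ?_
  have : (x ^ 3) ^ 3 + (x ^ 3) ^ 2 - a ^ 3 = (x ^ 3 + x ^ 2 - a) ^ 3 := by
    linear_combination (-(x ^ 6 * (x ^ 2 - a)) - x ^ 3 * (x ^ 2 - a) ^ 2 + x ^ 4 * a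
      - x ^ 2 * a ^ 2) * h3
  rw [this, map_pow]
  rcases quadraticChar_isQuadratic F (x ^ 3 + x ^ 2 - a) with h | h | h <;> rw [h] <;> norm_num

/-- Inverting s and dividing out the square s⁴ turns the twisted quartic into a cubic in r = s⁻¹.
The term s = 0 vanishes on the left but would give 1 after inversion, whence the -1. -/
theorem sum_quadraticChar_twist {a : F} (ha : a ≠ 0) :
    ∑ s : F, quadraticChar F s * quadraticChar F (s ^ 3 + s ^ 2 + s - a) = curveSum a - 1 := by
  have h3 : (3 : F) = 0 := three_eq_zero
  have h1 : ∀ s : F, quadraticChar F s * quadraticChar F (s ^ 3 + s ^ 2 + s - a) =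
      quadraticChar F (1 + s⁻¹ + s⁻¹ ^ 2 - a * s⁻¹ ^ 3) - if s = 0 then 1 else 0 := by
    intro s
    by_cases hs : s = 0
    · simp [hs]
    · rw [if_neg hs, sub_zero, ← map_mul, ← quadraticChar_mul_sq (pow_ne_zero 2 hs)
        (1 + s⁻¹ + s⁻¹ ^ 2 - a * s⁻¹ ^ 3)]
      congr 1
      field_simp
  simp only [h1, Finset.sum_sub_distrib, Finset.sum_ite_eq', Finset.mem_univ, if_true]
  congr 1
  rw [(inv_involutive (G := F)).bijective.sum_comp (fun r => quadraticChar F (1 + r + r ^ 2 - a * r ^ 3)),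
    ← curveSum_cube, curveSum]
  -- With r = 1 - x/a one has 1 + r + r² = (r - 1)² = x²/a² and ar³ = a - x³/a², so the cubic
  -- becomes (x³ + x² - a³)/a².
  let e : F ≃ F := (Equiv.mulLeft₀ (-a⁻¹) (by simpa using ha)).trans (Equiv.addRight 1)
  rw [← Equiv.sum_comp e]
  refine Finset.sum_congr rfl fun x _ => ?_
  rw [← quadraticChar_mul_sq ha]
  congr 1
  have he : e x = 1 - x / a := by
    change -a⁻¹ * x + 1 = _
    ring
  rw [he]
  field_simp
  linear_combination (a ^ 2 - a * x + a ^ 2 * x - a * x ^ 2) * h3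

/-- Count pairs (x, z) with x ≠ 0 and z³ - z = x + a/x in two ways: over x by Hilbert 90, over z by
the discriminant. The 3 is the contribution of x = 0 to the character sum. -/
theorem two_mul_K {a : F} (ha : a ≠ 0) :
    2 * K a = 3 + ((∑ z : F, quadraticChar F ((z ^ 3 - z) ^ 2 - a) : ℤ) : ℂ) := by
  have hK : K a = ∑ x : F, traceChar (x + a / x) := rfl
  have hneg : ∑ x : F, traceChar (-(x + a / x)) = K a := by
    rw [hK, ← Equiv.sum_comp (Equiv.neg F)]
    refine Finset.sum_congr rfl fun x _ => ?_
    simp only [Equiv.neg_apply, div_neg, neg_add, neg_neg]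
  have hq : ∑ x : F, (1 + traceChar (x + a / x) + traceChar (-(x + a / x))) =
      Fintype.card F + 2 * K a := by
    rw [Finset.sum_add_distrib, Finset.sum_add_distrib, hneg, ← hK]
    simp
    ring
  have hcount : ∑ x : F, (1 + traceChar (x + a / x) + traceChar (-(x + a / x))) =
      3 + ∑ x ∈ Finset.univ.filter (fun x : F => x ≠ 0),
        ((Finset.univ.filter fun z : F => z ^ 3 - z = x + a / x).card : ℂ) := by
    rw [← Finset.sum_filter_add_sum_filter_not Finset.univ (fun x : F => x = 0)]
    congr 1
    · rw [Finset.filter_eq' Finset.univ (0 : F), if_pos (Finset.mem_univ _),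
        Finset.sum_singleton]
      simp [traceChar]
      norm_num
    · exact Finset.sum_congr rfl fun x _ => (card_cube_sub_self _).symm
  have hswap : ∑ x ∈ Finset.univ.filter (fun x : F => x ≠ 0),
        (Finset.univ.filter fun z : F => z ^ 3 - z = x + a / x).card =
      ∑ z : F, (Finset.univ.filter fun x : F => x ≠ 0 ∧ x + a / x = z ^ 3 - z).card := by
    have := Finset.sum_card_bipartiteAbove_eq_sum_card_bipartiteBelow
      (s := Finset.univ.filter (fun x : F => x ≠ 0)) (t := Finset.univ)
      (fun x z : F => z ^ 3 - z = x + a / x)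
    simp only [Finset.bipartiteAbove, Finset.bipartiteBelow, Finset.filter_filter] at this
    rw [this]
    simp only [eq_comm]
  have hz : ((∑ x ∈ Finset.univ.filter (fun x : F => x ≠ 0),
        (Finset.univ.filter fun z : F => z ^ 3 - z = x + a / x).card : ℕ) : ℤ) =
      Fintype.card F + ∑ z : F, quadraticChar F ((z ^ 3 - z) ^ 2 - a) := by
    rw [hswap, Nat.cast_sum, Finset.sum_congr rfl fun z _ => card_add_div_eq ha _,
      Finset.sum_add_distrib]
    simp [add_comm]
  have hz' := congrArg (Int.cast : ℤ → ℂ) hz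
  rw [hq] at hcount
  push_cast at hz' ⊢
  rw [hz'] at hcount
  linear_combination hcount

theorem K_eq_one_add_curveSum {a : F} (ha : a ≠ 0) : K a = ((1 + curveSum a : ℤ) : ℂ) := by
  have h3 : (3 : F) = 0 := three_eq_zero
  have h := two_mul_K ha
  -- The argument depends only on s = z², so the sum splits into a plain and a twisted sum over s.
  have hs : ∑ z : F, quadraticChar F ((z ^ 3 - z) ^ 2 - a) = 2 * curveSum a - 1 := by
    have h1 : ∀ z : F, quadraticChar F ((z ^ 3 - z) ^ 2 - a) =
        (fun s => quadraticChar F (s ^ 3 + s ^ 2 + s - a)) (z ^ 2) := by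
      intro z
      simp only
      congr 1
      linear_combination (-z ^ 4) * h3
    simp only [h1]
    rw [sum_comp_sq (fun s => quadraticChar F (s ^ 3 + s ^ 2 + s - a))]
    simp only [add_mul, one_mul, Finset.sum_add_distrib]
    rw [sum_quadraticChar_twist ha, sum_quadraticChar_shift]
    ring
  rw [hs] at h
  push_cast at h ⊢
  linear_combination h / 2

/-- The trivial estimate, each character value being at most 1, suffices here in place of the Hasse
bound. -/
theorem two_mul_one_add_curveSum_le {a : F} (ha : a ≠ 0) :
    2 * (1 + curveSum a) ≤ Fintype.card F + 3 := by
  have h := two_mul_K ha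
  rw [K_eq_one_add_curveSum ha] at h
  have h' : 2 * (1 + curveSum a) = 3 + ∑ z : F, quadraticChar F ((z ^ 3 - z) ^ 2 - a) := by
    exact_mod_cast h
  rw [h', add_comm]
  gcongr
  calc ∑ z : F, quadraticChar F ((z ^ 3 - z) ^ 2 - a) ≤ ∑ _z : F, (1 : ℤ) := by
        refine Finset.sum_le_sum fun z _ => ?_
        rcases quadraticChar_isQuadratic F ((z ^ 3 - z) ^ 2 - a) with h | h | h <;> rw [h] <;>
          norm_num
    _ = Fintype.card F := by simp

theorem card_point {a : F} (ha : a ≠ 0) :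
    (Nat.card (curve a).Point : ℤ) = Fintype.card F + 1 + curveSum a := by
  have e1 : (curve a).Point ≃ Option {P : F × F // P ∈ E a} :=
    (WeierstrassCurve.Affine.nonsingularPointEquiv (curve a)).trans
      (Equiv.optionCongr (Equiv.subtypeEquivRight fun P =>
        ⟨fun h => mem_E_of_nonsingular h, fun h => curve_nonsingular ha h⟩))
  have e2 : {P : F × F // P ∈ E a} ≃ Σ x : F, {y : F // y ^ 2 = x ^ 3 + x ^ 2 - a} :=
    Equiv.subtypeProdEquivSigmaSubtype fun x y => y ^ 2 = x ^ 3 + x ^ 2 - a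
  rw [Nat.card_congr e1, Finite.card_option, Nat.card_congr e2, Nat.card_eq_fintype_card,
    Fintype.card_sigma]
  push_cast
  have : ∀ x : F, (Fintype.card {y : F // y ^ 2 = x ^ 3 + x ^ 2 - a} : ℤ) =
      quadraticChar F (x ^ 3 + x ^ 2 - a) + 1 := fun x => by
    rw [← card_sq_eq, Fintype.card_subtype]
  simp only [this, Finset.sum_add_distrib, curveSum]
  simp
  ring

end CharacterSum

/-! ### The sequence as an orbit of tripling -/

section Sequence

variable {F : Type*} [Field F] [Algebra (ZMod 3) F] [DecidableEq F]

open WeierstrassCurve.Affine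

/-- The terms of a tripling sequence are the `x`-coordinates of `3 ^ i • P`, as long as these
points are not the point at infinity. -/
theorem IsTriplingSeq.exists_eq_some {a : F} {u : ℕ → F} (hu : IsTriplingSeq a u)
    {P : (curve a).Point} {y : F} {h : (curve a).Nonsingular (u 1) y} (hP : P = Point.some _ y h)
    (ha : a ≠ 0) : ∀ i : ℕ, 3 ^ i • P ≠ 0 → ∃ z h', 3 ^ i • P = Point.some (u (i + 1)) z h' := by
  intro i
  induction i with
  | zero => exact fun _ => ⟨y, h, by simpa using hP⟩
  | succ i ih =>
    intro hi
    rw [pow_succ', mul_nsmul'] at hi ⊢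
    obtain ⟨z, h', e⟩ := ih fun h0 => hi (by rw [h0, smul_zero])
    rw [e] at hi ⊢
    have hne : u (i + 1) ^ 3 ≠ a := fun hx => hi ((three_nsmul_some_eq_zero_iff ha h').2 hx)
    obtain ⟨h'', e'⟩ := three_nsmul_some h' hne
    rw [e', hu (i + 1) (by omega) hne]
    exact ⟨_, h'', rfl⟩

/-- If n = 1, then 3^(k-1) P is the first point of order 3. If n ≠ 1, no 3^i P vanishes, and
tripling permutes ⟨3^k P⟩ up to sign, so the preperiod is exactly k. -/
theorem IsTriplingSeq.hits_or_repeats {a : F} {u : ℕ → F} (hu : IsTriplingSeq a u)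
    {P : (curve a).Point} {y : F} {h : (curve a).Nonsingular (u 1) y} (hP : P = Point.some _ y h)
    (ha : a ≠ 0) {k n : ℕ} (hk : 1 ≤ k) (hord : addOrderOf P = 3 ^ k * n) (hn : ¬ 3 ∣ n) :
    HitsCubeRootAt a u k ∨ FirstRepeatsFrom a u k := by
  have hs := hu.exists_eq_some hP ha
  have hiff : ∀ i, 3 ^ i • P ≠ 0 → (u (i + 1) ^ 3 = a ↔ 3 ^ (i + 1) • P = 0) := by
    intro i hi
    obtain ⟨z, h', e⟩ := hs i hi
    rw [pow_succ' 3 i, mul_nsmul', e, three_nsmul_some_eq_zero_iff ha]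
  by_cases hn1 : n = 1
  · left
    subst hn1
    rw [mul_one] at hord
    have hz : ∀ i, 3 ^ i • P = 0 ↔ k ≤ i := fun i => by
      rw [← addOrderOf_dvd_iff_nsmul_eq_zero, hord, Nat.pow_dvd_pow_iff_le_right (by norm_num)]
    obtain ⟨j, rfl⟩ : ∃ j, k = j + 1 := ⟨k - 1, by omega⟩
    refine ⟨(hiff j (by rw [Ne, hz]; omega)).2 ((hz _).2 le_rfl), fun i hi hij => ?_⟩
    obtain ⟨l, rfl⟩ : ∃ l, i = l + 1 := ⟨i - 1, by omega⟩
    rw [Ne, hiff l (by rw [Ne, hz]; omega), hz]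
    omega
  · right
    have hz : ∀ i, 3 ^ i • P ≠ 0 := fun i h0 => by
      have hd : n ∣ 3 ^ i :=
        (Dvd.intro_left _ rfl).trans (hord ▸ addOrderOf_dvd_iff_nsmul_eq_zero.2 h0)
      obtain ⟨j, -, hj⟩ := (Nat.dvd_prime_pow Nat.prime_three).1 hd
      rcases j with _ | j
      · exact hn1 (by simpa using hj)
      · exact hn (hj ▸ dvd_pow_self 3 (by omega))
    have heq : ∀ i j, u (i + 1) = u (j + 1) ↔
        3 ^ i • P = 3 ^ j • P ∨ (3 ^ i • P : (curve a).Point) = (-(3 ^ j • P : (curve a).Point) :) := by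
      intro i j
      obtain ⟨z, h', e⟩ := hs i (hz i)
      obtain ⟨z', h'', e'⟩ := hs j (hz j)
      rw [e, e', Point.X_eq_iff]
    have hshift : ∀ i j d, u (i + 1) = u (j + 1) → u (i + d + 1) = u (j + d + 1) := by
      intro i j d hij
      rw [heq] at hij ⊢
      rw [pow_add, pow_add, mul_comm (3 ^ i), mul_comm (3 ^ j), mul_nsmul', mul_nsmul']
      rcases hij with hij | hij
      · exact Or.inl (by rw [hij])
      · exact Or.inr (by rw [hij, smul_neg])
    have hex : ∃ r : ℕ, 1 ≤ r ∧ u (k + 1) = u (k + 1 + r) := by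
      obtain ⟨r, hr, e⟩ := exists_pow_three_nsmul_eq hord hn
      refine ⟨r, hr, ?_⟩
      rw [add_right_comm, heq]
      exact Or.inl e.symm
    refine ⟨fun i hi => ?_, Nat.find hex, (Nat.find_spec hex).1, (Nat.find_spec hex).2, ?_⟩
    · obtain ⟨l, rfl⟩ : ∃ l, i = l + 1 := ⟨i - 1, by omega⟩
      rw [Ne, hiff l (hz l)]
      exact hz _
    · intro i j hi hij hj he
      obtain ⟨i, rfl⟩ : ∃ l, i = l + 1 := ⟨i - 1, by omega⟩
      obtain ⟨j, rfl⟩ : ∃ l, j = l + 1 := ⟨j - 1, by omega⟩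
      have hki : k ≤ i := le_of_pow_three_nsmul_eq (by omega) (hord ▸ Dvd.intro _ rfl)
        ((heq i j).1 he)
      -- The subgroup generated by `3 ^ k • P` has order prime to three, so tripling is
      -- invertible on it and the coincidence can be pulled back to the index `k + 1`.
      have hback : u (k + 1) = u (k + (j - i) + 1) := by
        obtain ⟨r, hr, e⟩ := exists_pow_three_nsmul_eq hord hn
        have hper : ∀ c, 3 ^ (k + c * r) • P = 3 ^ k • P := by
          intro c
          induction c with
          | zero => simp
          | succ c ih =>
            rw [show k + (c + 1) * r = c * r + (k + r) by ring, pow_add, mul_nsmul', e,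
              ← mul_nsmul', ← pow_add, add_comm, ih]
        -- Moving forward from i to k + i r, a whole number of periods past k, undoes the shift from
        -- k to i.
        have hcr : i ≤ k + i * r := by nlinarith
        obtain ⟨d, hd⟩ : ∃ d, k + i * r = i + d := ⟨k + i * r - i, by omega⟩
        have h1 := hshift i j d he
        rw [heq] at h1 ⊢
        have e1 : 3 ^ (i + d) • P = 3 ^ k • P := by rw [← hd, hper]
        have e2 : 3 ^ (j + d) • P = 3 ^ (k + (j - i)) • P := by
          rw [show j + d = (j - i) + (i + d) by omega, pow_add, mul_nsmul', e1, ← mul_nsmul',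
            ← pow_add, add_comm]
        rwa [e1, e2] at h1
      exact Nat.find_min hex (m := j - i) (by omega)
        ⟨by omega, by rw [add_right_comm]; exact hback⟩

end Sequence

end TernaryKloosterman

/-! ### Comparing the order of P with K(a) -/

open TernaryKloosterman WeierstrassCurve.Affine in
theorem theorem1 {F : Type*} [Field F] [Fintype F] [Algebra (ZMod 3) F]
    (m : ℕ) (hm : 2 ≤ m) (hF : Fintype.card F = 3 ^ m)
    (a : F) (ha : a ≠ 0)
    (u : ℕ → F) (hu : TernaryKloosterman.IsTriplingSeq a u)
    (y : F) (hy : (u 1, y) ∈ TernaryKloosterman.E a)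
    (htr : Algebra.trace (ZMod 3) F (a * y / u 1 ^ 3) ≠ 0) :
    ∃ N : ℤ, TernaryKloosterman.K a = (N : ℂ) ∧
      ∃ k : ℕ, 1 ≤ k ∧ k ≤ m ∧
        (TernaryKloosterman.HitsCubeRootAt a u k ∨ TernaryKloosterman.FirstRepeatsFrom a u k) ∧
        TernaryKloosterman.ExactPower m k N := by
  classical
  have h := curve_nonsingular ha hy
  obtain ⟨P, hP⟩ : ∃ P : (curve a).Point, P = Point.some (u 1) y h := ⟨_, rfl⟩
  have hcard := card_point ha
  have hle := two_mul_one_add_curveSum_le ha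
  have hfin : Finite (curve a).Point := by
    have : Finite (WithZero {P : F × F // (curve a).Nonsingular P.1 P.2}) :=
      inferInstanceAs (Finite (Option _))
    exact Finite.of_equiv _ (nonsingularPointEquiv (curve a)).symm
  have : Fact (Nat.Prime 3) := ⟨Nat.prime_three⟩
  have hdiv : ∀ Q : (curve a).Point, 3 • Q ≠ P := fun Q hQ =>
    htr (trace_eq_zero_of_three_nsmul ha h (hQ.trans hP))
  have hindex := not_dvd_index_zmultiples (card_three_torsion_le ha) hdiv
  have hpos : addOrderOf P ≠ 0 := (addOrderOf_pos P).ne'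
  obtain ⟨k, n, hn, hord⟩ := Nat.exists_eq_pow_mul_and_not_dvd hpos 3 (by norm_num)
  have hmul := AddSubgroup.card_mul_index (AddSubgroup.zmultiples P)
  rw [Nat.card_zmultiples, hord, mul_assoc] at hmul
  obtain ⟨l, hl⟩ : ∃ l, l = n * (AddSubgroup.zmultiples P).index := ⟨_, rfl⟩
  have hl3 : ¬ 3 ∣ l := by
    rw [hl, Nat.prime_three.dvd_mul]
    tauto
  rw [← hl] at hmul
  -- If k = 0, the group order is prime to 3 and every point is a triple.
  have hk1 : 1 ≤ k := by
    by_contra hk0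
    have hk0 : k = 0 := by omega
    subst hk0
    have h3 : ¬ 3 ∣ Nat.card (curve a).Point := by rwa [← hmul, pow_zero, one_mul]
    have hc : (Nat.card (curve a).Point).Coprime 3 :=
      ((Nat.Prime.coprime_iff_not_dvd Nat.prime_three).2 h3).symm
    exact hdiv ((nsmulCoprime hc).symm P) ((nsmulCoprime hc).apply_symm_apply P)
  have hN : (3 : ℤ) ^ k * l = 3 ^ m + (1 + curveSum a) := by
    have h1 : ((3 ^ k * l : ℕ) : ℤ) = (Nat.card (curve a).Point : ℤ) := by rw [hmul]
    rw [hcard, hF] at h1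
    push_cast at h1
    linarith
  rw [hF] at hle
  push_cast at hle
  have hpowm : (9 : ℤ) ≤ 3 ^ m := by
    calc (9 : ℤ) = 3 ^ 2 := by norm_num
      _ ≤ 3 ^ m := pow_le_pow_right₀ (by norm_num) hm
  have hl0 : 0 < l := Nat.pos_of_ne_zero (by rintro rfl; simp at hl3)
  -- The order 3^k l is a positive multiple of 3^m below 2·3^m; here m ≥ 2 is needed, through 3^m >
  -- 3.
  have hlarge : m ≤ k → k = m ∧ 1 + curveSum a = 0 := by
    intro hmk
    obtain ⟨d, rfl⟩ : ∃ d, k = m + d := ⟨k - m, by omega⟩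
    have h1 : ((3 ^ d * l : ℕ) : ℤ) < 2 := by
      by_contra h2
      have h2 : (2 : ℤ) ≤ ((3 ^ d * l : ℕ) : ℤ) := by omega
      have h3 : (3 : ℤ) ^ m * 2 ≤ 3 ^ m * ((3 ^ d * l : ℕ) : ℤ) := by gcongr
      push_cast at h3
      rw [← mul_assoc, ← pow_add, hN] at h3
      linarith
    have h2 : 3 ^ d * l = 1 := by
      have : 0 < 3 ^ d * l := by positivity
      have : 3 ^ d * l < 2 := by exact_mod_cast h1
      omega
    have hd : d = 0 := by
      rcases Nat.eq_zero_or_pos d with hd | hd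
      · exact hd
      · have := Nat.eq_one_of_mul_eq_one_right h2
        simp at this
        omega
    subst hd
    have hl1 : l = 1 := by simpa using h2
    subst hl1
    refine ⟨rfl, ?_⟩
    simp at hN
    linarith
  refine ⟨1 + curveSum a, K_eq_one_add_curveSum ha, k, hk1, ?_,
    hu.hits_or_repeats hP ha hk1 hord hn, ?_⟩
  · by_contra hk
    have := (hlarge (by omega)).1
    omega
  · by_cases hmk : m ≤ k
    · exact Or.inr ⟨(hlarge hmk).2, (hlarge hmk).1⟩
    · have hdvd : ∀ j, j ≤ m → ((3 : ℤ) ^ j ∣ 1 + curveSum a ↔ (3 : ℤ) ^ j ∣ 3 ^ k * l) := by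
        intro j hj
        rw [hN]
        exact (dvd_add_right (pow_dvd_pow 3 hj)).symm
      have hnd : ¬ (3 : ℤ) ^ (k + 1) ∣ 1 + curveSum a := by
        rw [hdvd _ (by omega), pow_succ, mul_dvd_mul_iff_left (by positivity)]
        exact_mod_cast hl3
      refine Or.inl ⟨fun h0 => hnd (h0 ▸ dvd_zero _), ?_, hnd⟩
      rw [hdvd _ (by omega)]
      exact Dvd.intro _ rfl
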